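/- Let $p$ be a prime, let $I$ be a finite set, and let $A$ be an affinoid algebra over $\mathbb{Q}_p$, that is, a commutative Banach $\mathbb{Q}_p$-algebra (with a complete non-archimedean norm) that admits a continuous surjective homomorphism of $\mathbb{Q}_p$-algebras from a Tate algebra $\mathbb{Q}_p\langle X_1,\dots,X_m\rangle$. For $t=(t_\alpha)_{\alpha\in I}$ with $t_\alpha\in\mathbb{Q}_{>0}\cup\{\infty\}$ consider the Gauss norm $$\Big\|\sum_i a_iT^i\Big\|_t=\sup_i\ \|a_i\|\prod_{\alpha\in I}\big(p^{-t_\alpha/(p-1)}\big)^{i_\alpha},\qquad p^{-\infty}:=0,\quad 0^0:=1,$$ where exponents $i_\alpha$ with $t_\alpha=\infty$ are required to be $\ge 0$. For $s=(s_\alpha)\in\mathbb{Q}_{>0}^I$ and $r=(r_\alpha)\in\mathbb{Q}_{>0}^I$ with $s_\alpha\le r_\alpha$ for all $\alpha$, let $\Pi_{[s,r],I,A}$ be the Banach $A$-algebra obtained by completing $A[T_\alpha^{\pm1}:\alpha\in I]$ with respect to $\|\cdot\|_{[s,r]}=\max\{\|\cdot\|_t : t_\alpha\in\{s_\alpha,r_\alpha\}\text{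 for all }\alpha\}$ (the analytic functions, relative to $A$, on a closed polyannulus). For $r=\infty_I:=(\infty)_{\alpha\in I}$ let $\Pi_{[s,\infty_I],I,A}$ be the completion of $A[T_\alpha:\alpha\in I]$ with respect to the same formula, which there equals $\|\cdot\|_s$ (the analytic functions, relative to $A$, on a closed polydisc). Let $r_{I,n}=(r_{\alpha,n})_{\alpha\in I}$, $n\ge 0$, be a sequence of multiradii with $r_{\alpha,n}\in\mathbb{Q}_{>0}\cup\{\infty\}$ such that $r_{\alpha,n+1}\le r_{\alpha,n}$ for all $\alpha\in I$ and $n\ge 0$, $r_{\alpha,1}<r_{\alpha,0}$ for all $\alpha\in I$, and the $r_{\alpha,0}$ $(\alpha\in I)$ are either all finite or all equal to $\infty$. Then for every $n\ge 1$ the rings $\Pi_{[r_{I,n},r_{I,0}],I,A}$ and $\Pi_{[r_{I,n},\infty_I],I,A}$ are noetherian. -/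

import Mathlib

open scoped NNReal

noncomputable section

/-- A Banach `ℚ_p`-algebra `A` is affinoid if it is a quotient of a Tate algebra
`T_m = ℚ_p⟨X₁, …, X_m⟩`: there is a surjective homomorphism of `ℚ_p`-algebras `T_m → A` that is
continuous (equivalently, bounded) for the Gauss norm on `T_m`. Here `T_m` is the ring of
power series whose coefficients tend to zero. -/
def IsAffinoidAlgebra (p : ℕ) [Fact p.Prime] (A : Type*) [NormedCommRing A]
    [NormedAlgebra ℚ_[p] A] : Prop :=
  ∃ (m : ℕ) (φ : MvPowerSeries.IsRestricted.subring (R := ℚ_[p]) (σ := Fin m) (fun _ => 1) →+* A),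
    Function.Surjective φ ∧
    (∀ a : ℚ_[p], φ ⟨MvPowerSeries.C a, MvPowerSeries.isRestricted_C _ a⟩ = algebraMap ℚ_[p] A a) ∧
    ∃ K : ℝ, ∀ f, ‖φ f‖ ≤ K * MvPowerSeries.gaussNorm (fun a => ‖a‖) (fun _ => 1) f.1

/-- The absolute value `p ^ (-t / (p - 1))` of a coordinate on the circle with parameter `t`; the
parameter `t = ∞` corresponds to the centre, where the absolute value is `0`. -/
def circleRadius (p : ℕ) : WithTop ℚ → ℝ≥0
  | ⊤ => 0
  | (t : ℚ) => (p : ℝ≥0) ^ (-(t : ℝ) / ((p : ℝ) - 1))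

/-- The value `∏ |T_α| ^ (i_α)` of the monomial `T ^ i` at the multiradius with parameter `t`. -/
def monomialWeight (p : ℕ) {I : Type*} [Fintype I] (t : I → WithTop ℚ) (i : I → ℤ) : ℝ≥0 :=
  ∏ α, circleRadius p (t α) ^ i α

/-- The exponents of the monomials that are functions on the polyannulus `[s, r]`: all integral
exponents in the directions where the parameters are finite (annuli), and the nonnegative ones in
the directions with an infinite parameter (discs). -/
def annulusExponents {I : Type*} (s r : I → WithTop ℚ) : AddSubmonoid (I → ℤ) where
  carrier := {i | ∀ α, s α = ⊤ ∨ r α = ⊤ → 0 ≤ i α}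
  zero_mem' := fun _ _ => le_rfl
  add_mem' := fun hi hj α h => add_nonneg (hi α h) (hj α h)

/-- The multiradii `t` with `t_α ∈ {s_α, r_α}` for all `α`, indexed by the set of those `α` at
which `r_α` is chosen. -/
def annulusVertex {I : Type*} (s r : I → WithTop ℚ) (J : Finset I) (α : I) : WithTop ℚ :=
  @ite _ (α ∈ J) (Classical.dec _) (r α) (s α)

/-- The ring of (Laurent) polynomials on the polyannulus `[s, r]` with coefficients in `A`: for
finite `s`, `r` this is `A[T_α^{±1}, α ∈ I]`, for `r = ∞` it is `A[T_α, α ∈ I]`. -/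
def AnnulusPolynomial (_p : ℕ) (A : Type*) [CommRing A] {I : Type*} (s r : I → WithTop ℚ) :
    Type _ :=
  AddMonoidAlgebra A (annulusExponents s r)

namespace AnnulusPolynomial

variable (p : ℕ) (A : Type*) {I : Type*} (s r : I → WithTop ℚ)

instance instCommRing [CommRing A] : CommRing (AnnulusPolynomial p A s r) :=
  inferInstanceAs (CommRing (AddMonoidAlgebra A (annulusExponents s r)))

instance instAlgebra [CommRing A] : Algebra A (AnnulusPolynomial p A s r) :=
  inferInstanceAs (Algebra A (AddMonoidAlgebra A (annulusExponents s r)))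

variable {p A s r}

/-- The coefficients of a (Laurent) polynomial. -/
def coeff [CommRing A] (f : AnnulusPolynomial p A s r) : annulusExponents s r →₀ A :=
  AddMonoidAlgebra.coeff f

lemma circleRadius_ne_zero [Fact p.Prime] {t : WithTop ℚ} (ht : t ≠ ⊤) :
    circleRadius p t ≠ 0 := by
  obtain ⟨q, rfl⟩ := WithTop.ne_top_iff_exists.1 ht
  have hp : (p : ℝ≥0) ≠ 0 := by exact_mod_cast (Fact.out : p.Prime).ne_zero
  exact fun h => hp ((NNReal.rpow_eq_zero_iff.1 h).1)

lemma annulusVertex_ne_top {J : Finset I} {α : I} (h : ¬ (s α = ⊤ ∨ r α = ⊤)) :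
    annulusVertex s r J α ≠ ⊤ := by
  rw [not_or] at h
  unfold annulusVertex
  split_ifs
  exacts [h.2, h.1]

lemma monomialWeight_zero [Fintype I] (t : I → WithTop ℚ) : monomialWeight p t 0 = 1 := by
  simp [monomialWeight]

lemma monomialWeight_add [Fact p.Prime] [Fintype I] (J : Finset I) (i j : annulusExponents s r) :
    monomialWeight p (annulusVertex s r J) ((i + j : annulusExponents s r) : I → ℤ) =
      monomialWeight p (annulusVertex s r J) i * monomialWeight p (annulusVertex s r J) j := by
  unfold monomialWeight
  rw [← Finset.prod_mul_distrib]
  refine Finset.prod_congr rfl fun α _ => ?_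
  by_cases ht : s α = ⊤ ∨ r α = ⊤
  · obtain ⟨a, ha⟩ := Int.eq_ofNat_of_zero_le (i.2 α ht)
    obtain ⟨b, hb⟩ := Int.eq_ofNat_of_zero_le (j.2 α ht)
    simp only [AddSubmonoid.coe_add, Pi.add_apply, ha, hb]
    rw [← Nat.cast_add, zpow_natCast, zpow_natCast, zpow_natCast, pow_add]
  · exact zpow_add₀ (circleRadius_ne_zero (annulusVertex_ne_top ht)) _ _

section Norm

variable [NormedCommRing A] [Fintype I]

/-- The Gauss norm `sup_i ‖a_i‖ · |T ^ i|` of `f = ∑ a_i T ^ i` at the multiradius with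
parameter `t`. -/
def gaussNorm (t : I → WithTop ℚ) (f : AnnulusPolynomial p A s r) : ℝ≥0 :=
  f.coeff.support.sup fun i => ‖f.coeff i‖₊ * monomialWeight p t i

/-- The norm on the polyannulus `[s, r]`: the maximum of the Gauss norms at all multiradii `t`
with `t_α ∈ {s_α, r_α}`. -/
def annulusNorm (f : AnnulusPolynomial p A s r) : ℝ≥0 :=
  Finset.univ.sup fun J : Finset I => f.gaussNorm (annulusVertex s r J)

lemma le_gaussNorm (t : I → WithTop ℚ) (f : AnnulusPolynomial p A s r)
    (i : annulusExponents s r) :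
    ‖f.coeff i‖₊ * monomialWeight p t i ≤ f.gaussNorm t := by
  by_cases hi : i ∈ f.coeff.support
  · exact Finset.le_sup (f := fun i => ‖f.coeff i‖₊ * monomialWeight p t i) hi
  · simp [Finsupp.notMem_support_iff.1 hi]

lemma gaussNorm_le {t : I → WithTop ℚ} {f : AnnulusPolynomial p A s r} {c : ℝ≥0}
    (h : ∀ i : annulusExponents s r, ‖f.coeff i‖₊ * monomialWeight p t i ≤ c) :
    f.gaussNorm t ≤ c :=
  Finset.sup_le fun i _ => h i

lemma gaussNorm_le_annulusNorm (f : AnnulusPolynomial p A s r) (J : Finset I) :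
    f.gaussNorm (annulusVertex s r J) ≤ f.annulusNorm :=
  Finset.le_sup (f := fun J : Finset I => f.gaussNorm (annulusVertex s r J)) (Finset.mem_univ J)

lemma gaussNorm_add_le (t : I → WithTop ℚ) (f g : AnnulusPolynomial p A s r) :
    (f + g).gaussNorm t ≤ f.gaussNorm t + g.gaussNorm t :=
  gaussNorm_le fun i => by
    have h : (f + g).coeff i = f.coeff i + g.coeff i := rfl
    rw [h]
    calc ‖f.coeff i + g.coeff i‖₊ * monomialWeight p t i
        ≤ (‖f.coeff i‖₊ + ‖g.coeff i‖₊) * monomialWeight p t i := by gcongr; exact nnnorm_add_le _ _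
      _ = ‖f.coeff i‖₊ * monomialWeight p t i + ‖g.coeff i‖₊ * monomialWeight p t i := add_mul _ _ _
      _ ≤ _ := add_le_add (le_gaussNorm t f i) (le_gaussNorm t g i)

lemma gaussNorm_neg (t : I → WithTop ℚ) (f : AnnulusPolynomial p A s r) :
    (-f).gaussNorm t = f.gaussNorm t := by
  have h : ∀ g : AnnulusPolynomial p A s r, (-g).gaussNorm t ≤ g.gaussNorm t := fun g =>
    gaussNorm_le fun i => by
      have h : (-g).coeff i = -g.coeff i := rfl
      rw [h, nnnorm_neg]
      exact le_gaussNorm t g i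
  exact le_antisymm (h f) (by simpa using h (-f))

lemma gaussNorm_smul_le (t : I → WithTop ℚ) (a : A) (f : AnnulusPolynomial p A s r) :
    (a • f).gaussNorm t ≤ ‖a‖₊ * f.gaussNorm t :=
  gaussNorm_le fun i => by
    have h : (a • f).coeff i = a * f.coeff i := rfl
    rw [h]
    calc ‖a * f.coeff i‖₊ * monomialWeight p t i
        ≤ ‖a‖₊ * ‖f.coeff i‖₊ * monomialWeight p t i := by gcongr; exact nnnorm_mul_le _ _
      _ = ‖a‖₊ * (‖f.coeff i‖₊ * monomialWeight p t i) := mul_assoc _ _ _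
      _ ≤ _ := by gcongr; exact le_gaussNorm t f i

lemma gaussNorm_mul_le [Fact p.Prime] [IsUltrametricDist A] (J : Finset I)
    (f g : AnnulusPolynomial p A s r) :
    (f * g).gaussNorm (annulusVertex s r J) ≤
      f.gaussNorm (annulusVertex s r J) * g.gaussNorm (annulusVertex s r J) := by
  classical
  refine gaussNorm_le fun k => ?_
  have hc : (f * g).coeff k = ∑ i ∈ f.coeff.support, ∑ j ∈ g.coeff.support,
      if i + j = k then f.coeff i * g.coeff j else 0 :=
    AddMonoidAlgebra.coeff_mul (R := A) (M := annulusExponents s r) f g k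
  rw [hc]
  set w := fun i : annulusExponents s r => monomialWeight p (annulusVertex s r J) i with hw
  set c := f.gaussNorm (annulusVertex s r J) * g.gaussNorm (annulusVertex s r J) with hcdef
  have key : ∀ x : A, ∀ c' : ℝ≥0, ‖x‖₊ ≤ c' → ‖x‖₊ * w k ≤ c' * w k := fun x c' h => by gcongr
  have sums : ∀ (S : Finset (annulusExponents s r)) (F : annulusExponents s r → A),
      (∀ i ∈ S, ‖F i‖₊ * w k ≤ c) → ‖∑ i ∈ S, F i‖₊ * w k ≤ c := by
    intro S F hF
    induction S using Finset.induction_on with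
    | empty => simp
    | insert a S ha ih =>
      rw [Finset.sum_insert ha]
      have h1 := hF a (Finset.mem_insert_self a S)
      have h2 := ih fun i hi => hF i (Finset.mem_insert_of_mem hi)
      have h3 : ‖F a + ∑ i ∈ S, F i‖₊ ≤ max ‖F a‖₊ ‖∑ i ∈ S, F i‖₊ :=
        IsUltrametricDist.norm_add_le_max _ _
      rcases le_max_iff.1 h3 with h | h
      · exact (key _ _ h).trans h1
      · exact (key _ _ h).trans h2
  refine sums _ _ fun i _ => sums _ _ fun j _ => ?_
  split_ifs with hij
  · subst hij
    calc ‖f.coeff i * g.coeff j‖₊ * w (i + j)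
        ≤ (‖f.coeff i‖₊ * ‖g.coeff j‖₊) * (w i * w j) := by
          rw [hw]
          simp only [monomialWeight_add]
          gcongr
          exact nnnorm_mul_le _ _
      _ = (‖f.coeff i‖₊ * w i) * (‖g.coeff j‖₊ * w j) := by ring
      _ ≤ c := mul_le_mul' (le_gaussNorm _ f i) (le_gaussNorm _ g j)
  · simp

variable (p A s r) in
/-- The norm on the polyannulus is a submultiplicative seminorm. -/
def ringSeminorm [Fact p.Prime] [IsUltrametricDist A] :
    RingSeminorm (AnnulusPolynomial p A s r) where
  toFun f := f.annulusNorm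
  map_zero' := by
    have h : (0 : AnnulusPolynomial p A s r).annulusNorm ≤ 0 :=
      Finset.sup_le fun J _ => gaussNorm_le fun i => by
        have h : (0 : AnnulusPolynomial p A s r).coeff i = 0 := rfl
        simp [h]
    exact_mod_cast le_antisymm h bot_le
  add_le' f g := by
    have h : (f + g).annulusNorm ≤ f.annulusNorm + g.annulusNorm :=
      Finset.sup_le fun J _ => (gaussNorm_add_le _ f g).trans
        (add_le_add (gaussNorm_le_annulusNorm f J) (gaussNorm_le_annulusNorm g J))
    exact_mod_cast h
  neg' f := by simp only [annulusNorm, gaussNorm_neg]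
  mul_le' f g := by
    have h : (f * g).annulusNorm ≤ f.annulusNorm * g.annulusNorm :=
      Finset.sup_le fun J _ => (gaussNorm_mul_le J f g).trans
        (mul_le_mul' (gaussNorm_le_annulusNorm f J) (gaussNorm_le_annulusNorm g J))
    exact_mod_cast h

instance instSeminormedCommRing [Fact p.Prime] [IsUltrametricDist A] :
    SeminormedCommRing (AnnulusPolynomial p A s r) where
  __ := (ringSeminorm p A s r).toSeminormedRing
  mul_comm := mul_comm

lemma norm_def [Fact p.Prime] [IsUltrametricDist A] (f : AnnulusPolynomial p A s r) :
    ‖f‖ = f.annulusNorm := rfl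

instance instIsBoundedSMul [Fact p.Prime] [IsUltrametricDist A] :
    IsBoundedSMul A (AnnulusPolynomial p A s r) :=
  IsBoundedSMul.of_norm_smul_le fun a f => by
    have h : (a • f).annulusNorm ≤ ‖a‖₊ * f.annulusNorm :=
      Finset.sup_le fun J _ => (gaussNorm_smul_le _ a f).trans
        (mul_le_mul' le_rfl (gaussNorm_le_annulusNorm f J))
    exact_mod_cast h

end Norm

end AnnulusPolynomial

/-- The ring `Π_{[s, r], I, A}` of analytic functions, relative to the Banach algebra `A`, on the
closed polyannulus of all points whose `α`-th coordinate has absolute value between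
`p ^ (-r_α / (p - 1))` and `p ^ (-s_α / (p - 1))`, where `p ^ (-∞) = 0`: the Banach `A`-algebra
obtained by completing the ring of (Laurent) polynomials for the norm on the polyannulus. -/
abbrev AnnulusRing (p : ℕ) [Fact p.Prime] (A : Type*) [NormedCommRing A] [IsUltrametricDist A]
    {I : Type*} [Fintype I] (s r : I → WithTop ℚ) : Type _ :=
  UniformSpace.Completion (AnnulusPolynomial p A s r)

end

noncomputable section

open Filter Topology

/-! The ring of a polyannulus is a quotient of a ring of power series over `ℚ_[p]` converging on a
closed polydisc, and that ring is noetherian by a Gröbner basis argument.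

Noetherianity (`RestrictedSeries.isNoetherianRing`): among the terms where the Gauss norm of a
series is attained, the largest in a monomial order is leading. By Dickson's lemma the leading
exponents of an ideal have finitely many minimal elements. Dividing by series `G i` of the ideal
with these leading exponents strictly lowers the norm. The radii are rational powers of `p`, so all
norms are powers of one `τ < 1`; hence each division gains at least a factor `τ`, and successive
approximation expresses every element of the ideal by the `G i`.

Quotient (`AnnulusRing.isNoetherianRing_of_generators`): the variables are those of a Tate algebra
presenting `A`, with radius `1`, together with one variable for each `T_α`, of radius that of `s_α`,
and one for each `T_α⁻¹` that exists, of radius inverse to that of `r_α`. Dense image would not give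
surjectivity, so approximate preimages with controlled norm are needed: the open mapping theorem
lifts the coefficients, and each monomial `T ^ i` lifts to a monomial whose weight is the weight of
`T ^ i` at one vertex of the polyannulus. -/

/-- Successive approximation: if every element `y` of a subgroup `S` is the image, up to an error
of norm at most `θ * ‖y‖` with `θ < 1`, of an element of norm at most `C * ‖y‖`, then every element
of `S` is an image. -/
lemma exists_eq_of_approx {E F : Type*} [NormedAddCommGroup E] [CompleteSpace E]
    [NormedAddCommGroup F] (Φ : E →+ F) (hΦ : Continuous Φ) (S : AddSubgroup F) {C θ : ℝ}
    (hθ0 : 0 ≤ θ) (hθ : θ < 1) (hS : ∀ x, Φ x ∈ S)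
    (h : ∀ y ∈ S, ∃ x, ‖x‖ ≤ C * ‖y‖ ∧ ‖y - Φ x‖ ≤ θ * ‖y‖) :
    ∀ y ∈ S, ∃ x, Φ x = y := by
  intro y hy
  choose! g hg using h
  -- The `u n` are the successive residuals. They decay like `θ ^ n`, and the images of the
  -- corrections `g (u n)` telescope to `y - u n`.
  let u : ℕ → F := fun n => Nat.rec y (fun _ z => z - Φ (g z)) n
  have hu0 : u 0 = y := rfl
  have hus : ∀ n, u (n + 1) = u n - Φ (g (u n)) := fun n => rfl
  have huS : ∀ n, u n ∈ S := by
    intro n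
    induction n with
    | zero => exact hy
    | succ n ih => rw [hus]; exact S.sub_mem ih (hS _)
  have hun : ∀ n, ‖u n‖ ≤ θ ^ n * ‖y‖ := by
    intro n
    induction n with
    | zero => simp [hu0]
    | succ n ih =>
      rw [hus, pow_succ, mul_comm (θ ^ n), mul_assoc]
      exact ((hg _ (huS n)).2).trans (by gcongr)
  have hsum : Summable fun n => g (u n) := by
    refine Summable.of_norm_bounded (g := fun n => |C| * (θ ^ n * ‖y‖)) ?_ fun n => ?_
    · exact ((summable_geometric_of_lt_one hθ0 hθ).mul_right _).mul_left _
    · calc ‖g (u n)‖ ≤ C * ‖u n‖ := (hg _ (huS n)).1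
        _ ≤ |C| * ‖u n‖ := by gcongr; exact le_abs_self C
        _ ≤ _ := by gcongr; exact hun n
  refine ⟨∑' n, g (u n), ?_⟩
  have h1 := (hsum.hasSum.map Φ hΦ).tendsto_sum_nat
  have h2 : ∀ n, ∑ i ∈ Finset.range n, (Φ ∘ fun n => g (u n)) i = y - u n := by
    intro n
    induction n with
    | zero => simp [hu0]
    | succ n ih => rw [Finset.sum_range_succ, ih, hus]; simp only [Function.comp]; abel
  simp only [h2] at h1
  have h3 : Tendsto u atTop (𝓝 0) := by
    refine squeeze_zero_norm hun ?_
    simpa using (tendsto_pow_atTop_nhds_zero_of_lt_one hθ0 hθ).mul_const ‖y‖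
  have h4 : Tendsto (fun n => y - u n) atTop (𝓝 y) := by simpa using h3.const_sub y
  exact tendsto_nhds_unique h1 h4

/-! ### Restricted power series as a complete ultrametric normed ring. -/

/-- The ring `𝕜⟨X_j / ρ_j⟩` of power series converging on the closed polydisc of radii `ρ`. -/
abbrev RestrictedSeries (𝕜 : Type*) [NormedField 𝕜] [IsUltrametricDist 𝕜] {σ : Type*}
    (ρ : σ → ℝ) : Type _ :=
  MvPowerSeries.IsRestricted.subring (R := 𝕜) ρ

namespace RestrictedSeries

/-- The value `∏ ρ_j ^ t_j` of the monomial with exponent `t`. -/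
def weight {σ : Type*} (ρ : σ → ℝ) (t : σ →₀ ℕ) : ℝ := t.prod (ρ · ^ ·)

section Weight

variable {σ : Type*} {ρ : σ → ℝ}

lemma weight_add (s t : σ →₀ ℕ) : weight ρ (s + t) = weight ρ s * weight ρ t := by
  classical
  exact Finsupp.prod_add_index' (h := (ρ · ^ ·)) (by simp) (fun _ _ _ => pow_add _ _ _)

lemma weight_pos [hρ : Fact (∀ j, 0 < ρ j)] (t : σ →₀ ℕ) : 0 < weight ρ t :=
  Finset.prod_pos fun j _ => pow_pos (hρ.out j) _

end Weight

variable {𝕜 : Type*} [NormedField 𝕜] [IsUltrametricDist 𝕜] {σ : Type*} {ρ : σ → ℝ}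

/-- The coefficients of a restricted power series, as an additive map. -/
def coeff (t : σ →₀ ℕ) : RestrictedSeries 𝕜 ρ →+ 𝕜 :=
  ((MvPowerSeries.coeff t : MvPowerSeries σ 𝕜 →ₗ[𝕜] 𝕜).toAddMonoidHom).comp
    (MvPowerSeries.IsRestricted.subring (R := 𝕜) ρ).subtype.toAddMonoidHom

/-- The monomial `a X ^ t`. -/
def monomial (t : σ →₀ ℕ) (a : 𝕜) : RestrictedSeries 𝕜 ρ :=
  ⟨MvPowerSeries.monomial t a, MvPowerSeries.isRestricted_monomial ρ t a⟩

lemma coeff_monomial [DecidableEq σ] (s t : σ →₀ ℕ) (a : 𝕜) :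
    coeff s (monomial t a : RestrictedSeries 𝕜 ρ) = if s = t then a else 0 :=
  MvPowerSeries.coeff_monomial s t a

lemma coeff_mul [DecidableEq σ] (t : σ →₀ ℕ) (f g : RestrictedSeries 𝕜 ρ) :
    coeff t (f * g) = ∑ x ∈ Finset.HasAntidiagonal.antidiagonal t, coeff x.1 f * coeff x.2 g :=
  MvPowerSeries.coeff_mul t f.1 g.1

lemma monomial_mul_monomial (s t : σ →₀ ℕ) (a b : 𝕜) :
    (monomial s a * monomial t b : RestrictedSeries 𝕜 ρ) = monomial (s + t) (a * b) :=
  Subtype.ext (MvPowerSeries.monomial_mul_monomial s t a b)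

lemma monomial_add (t : σ →₀ ℕ) (a b : 𝕜) :
    (monomial t (a + b) : RestrictedSeries 𝕜 ρ) = monomial t a + monomial t b :=
  Subtype.ext (map_add (MvPowerSeries.monomial t) a b)

lemma monomial_zero_one : (monomial 0 1 : RestrictedSeries 𝕜 ρ) = 1 :=
  Subtype.ext (MvPowerSeries.monomial_zero_one)

lemma tendsto_coeff (f : RestrictedSeries 𝕜 ρ) :
    Tendsto (fun t => ‖coeff t f‖ * weight ρ t) cofinite (𝓝 0) := f.2

lemma finite_le_coeff (f : RestrictedSeries 𝕜 ρ) {ε : ℝ} (hε : 0 < ε) :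
    {t | ε ≤ ‖coeff t f‖ * weight ρ t}.Finite := by
  have := (tendsto_coeff f).eventually (gt_mem_nhds hε)
  simpa [Filter.eventually_cofinite] using this

lemma hasGaussNorm (f : RestrictedSeries 𝕜 ρ) :
    MvPowerSeries.HasGaussNorm (fun a : 𝕜 => ‖a‖) ρ f.1 :=
  (tendsto_coeff f).bddAbove_range_of_cofinite

lemma isNonarchimedean_norm : IsNonarchimedean (fun a : 𝕜 => ‖a‖) :=
  fun a b => IsUltrametricDist.norm_add_le_max a b

variable [hρ : Fact (∀ j, 0 < ρ j)]

variable (𝕜 ρ) in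
/-- The Gauss norm as a ring norm. -/
def ringNorm : RingNorm (RestrictedSeries 𝕜 ρ) where
  toFun f := MvPowerSeries.gaussNorm (fun a : 𝕜 => ‖a‖) ρ f.1
  map_zero' := MvPowerSeries.gaussNorm_zero _ _ norm_zero
  add_le' f g := (MvPowerSeries.gaussNorm_add_le_max _ _ _ _ (fun j => (hρ.out j).le)
    (fun _ => norm_nonneg _) isNonarchimedean_norm (hasGaussNorm f) (hasGaussNorm g)).trans
    (max_le_add_of_nonneg (MvPowerSeries.gaussNorm_nonneg _ _ _ fun _ => norm_nonneg _)
      (MvPowerSeries.gaussNorm_nonneg _ _ _ fun _ => norm_nonneg _))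
  neg' _ := MvPowerSeries.gaussNorm_neg _ _ norm_neg _
  mul_le' f g := MvPowerSeries.gaussNorm_mul_le _ _ _ _ (fun j => (hρ.out j).le)
    (fun _ => norm_nonneg _) (fun _ _ => norm_mul_le _ _) isNonarchimedean_norm norm_zero
    (hasGaussNorm f) (hasGaussNorm g)
  eq_zero_of_map_eq_zero' f hf := Subtype.ext <|
    (MvPowerSeries.gaussNorm_eq_zero_iff _ _ _ norm_zero (fun _ => norm_nonneg _)
      (fun _ => norm_eq_zero.1) hρ.out (hasGaussNorm f)).1 hf

instance : NormedCommRing (RestrictedSeries 𝕜 ρ) where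
  __ := (ringNorm 𝕜 ρ).toNormedRing
  mul_comm := mul_comm

lemma coeff_mul_weight_le_norm (f : RestrictedSeries 𝕜 ρ) (t : σ →₀ ℕ) :
    ‖coeff t f‖ * weight ρ t ≤ ‖f‖ :=
  MvPowerSeries.le_gaussNorm _ _ _ (hasGaussNorm f) t

lemma norm_le_of_forall_coeff {f : RestrictedSeries 𝕜 ρ} {c : ℝ}
    (h : ∀ t, ‖coeff t f‖ * weight ρ t ≤ c) : ‖f‖ ≤ c :=
  ciSup_le h

instance : IsUltrametricDist (RestrictedSeries 𝕜 ρ) :=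
  IsUltrametricDist.isUltrametricDist_of_forall_norm_add_le_max_norm fun f g =>
    MvPowerSeries.gaussNorm_add_le_max _ _ _ _ (fun j => (hρ.out j).le)
      (fun _ => norm_nonneg _) isNonarchimedean_norm (hasGaussNorm f) (hasGaussNorm g)

lemma norm_monomial (t : σ →₀ ℕ) (a : 𝕜) :
    ‖(monomial t a : RestrictedSeries 𝕜 ρ)‖ = ‖a‖ * weight ρ t := by
  classical
  refine le_antisymm (norm_le_of_forall_coeff fun s => ?_) ?_
  · rw [coeff_monomial]
    split_ifs with h
    · rw [h]
    · simpa using mul_nonneg (norm_nonneg a) (weight_pos t).le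
  · simpa [coeff_monomial] using
      coeff_mul_weight_le_norm (monomial t a : RestrictedSeries 𝕜 ρ) t

/-- Only finitely many terms have size at least `‖f‖ / 2`, so the supremum is a maximum over a
finite set. -/
lemma exists_coeff_eq_norm (f : RestrictedSeries 𝕜 ρ) :
    ∃ t, ‖coeff t f‖ * weight ρ t = ‖f‖ := by
  by_cases hf : f = 0
  · exact ⟨0, by simp [hf]⟩
  by_contra! h
  have hpos : 0 < ‖f‖ := norm_pos_iff.2 hf
  have hfin := finite_le_coeff f (half_pos hpos)
  by_cases hne : hfin.toFinset.Nonempty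
  · obtain ⟨e, -, he⟩ := Finset.exists_max_image hfin.toFinset
      (fun t => ‖coeff t f‖ * weight ρ t) hne
    have hlt : ‖coeff e f‖ * weight ρ e < ‖f‖ :=
      lt_of_le_of_ne (coeff_mul_weight_le_norm f e) (h e)
    refine (max_lt hlt (half_lt_self hpos)).not_ge (norm_le_of_forall_coeff fun t => ?_)
    by_cases ht : ‖f‖ / 2 ≤ ‖coeff t f‖ * weight ρ t
    · exact le_max_of_le_left (he t (by simpa using ht))
    · exact le_max_of_le_right (not_le.1 ht).le
  · refine (half_lt_self hpos).not_ge (norm_le_of_forall_coeff fun t => ?_)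
    by_contra ht
    exact hne ⟨t, by simpa using (not_le.1 ht).le⟩

lemma exists_norm_sub_sum_monomial_le (f : RestrictedSeries 𝕜 ρ) {ε : ℝ} (hε : 0 < ε) :
    ∃ S : Finset (σ →₀ ℕ), ‖f - ∑ t ∈ S, monomial t (coeff t f)‖ ≤ ε := by
  classical
  refine ⟨(finite_le_coeff f hε).toFinset, norm_le_of_forall_coeff fun t => ?_⟩
  rw [map_sub, map_sum]
  simp only [coeff_monomial, Finset.sum_ite_eq, Set.Finite.mem_toFinset, Set.mem_ofPred_eq]
  split_ifs with h
  · simpa using hε.le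
  · simpa using (not_le.1 h).le

lemma continuous_coeff (t : σ →₀ ℕ) : Continuous (coeff t : RestrictedSeries 𝕜 ρ →+ 𝕜) := by
  refine AddMonoidHomClass.continuous_of_bound _ (weight ρ t)⁻¹ fun f => ?_
  rw [inv_mul_eq_div, le_div_iff₀ (weight_pos t)]
  exact coeff_mul_weight_le_norm f t

instance [CompleteSpace 𝕜] : CompleteSpace (RestrictedSeries 𝕜 ρ) := by
  refine Metric.complete_of_cauchySeq_tendsto fun u hu => ?_
  have hcoeff : ∀ t, ∃ a, Tendsto (fun n => coeff t (u n)) atTop (𝓝 a) := fun t =>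
    cauchySeq_tendsto_of_complete (hu.map
      (uniformContinuous_addMonoidHom_of_continuous (continuous_coeff t)))
  choose a ha using hcoeff
  -- Letting `k → ∞` in the Cauchy estimate bounds all coefficients with the same `N`. This
  -- uniformity makes the coefficientwise limit restricted and turns it into a limit in norm.
  have key : ∀ ε > 0, ∃ N, ∀ n ≥ N, ∀ t, ‖coeff t (u n) - a t‖ * weight ρ t ≤ ε := by
    intro ε hε
    obtain ⟨N, hN⟩ := Metric.cauchySeq_iff.1 hu ε hε
    refine ⟨N, fun n hn t => ?_⟩
    have hlim : Tendsto (fun k => ‖coeff t (u n) - coeff t (u k)‖ * weight ρ t) atTop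
        (𝓝 (‖coeff t (u n) - a t‖ * weight ρ t)) :=
      ((tendsto_const_nhds.sub (ha t)).norm).mul_const _
    refine le_of_tendsto hlim (eventually_atTop.2 ⟨N, fun k hk => ?_⟩)
    rw [← map_sub]
    exact (coeff_mul_weight_le_norm _ t).trans ((dist_eq_norm (u n) (u k)) ▸ (hN n hn k hk).le)
  have hres : MvPowerSeries.IsRestricted ρ (fun t => a t : MvPowerSeries σ 𝕜) := by
    refine tendsto_order.2 ?_
    refine ⟨fun b hb => Eventually.of_forall fun t =>
      hb.trans_le (mul_nonneg (norm_nonneg _) (weight_pos t).le), fun b hb => ?_⟩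
    obtain ⟨N, hN⟩ := key (b / 3) (by positivity)
    filter_upwards [(tendsto_coeff (u N)).eventually (gt_mem_nhds (show 0 < b / 3 by positivity))]
      with t ht
    have h1 : ‖a t‖ ≤ ‖coeff t (u N)‖ + ‖coeff t (u N) - a t‖ := by
      calc ‖a t‖ = ‖coeff t (u N) - (coeff t (u N) - a t)‖ := by rw [sub_sub_cancel]
        _ ≤ _ := norm_sub_le _ _
    have h2 := mul_le_mul_of_nonneg_right h1 (weight_pos (ρ := ρ) t).le
    have h3 := hN N le_rfl t
    rw [add_mul] at h2
    change ‖a t‖ * weight ρ t < b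
    linarith
  refine ⟨⟨fun t => a t, hres⟩, Metric.tendsto_atTop.2 fun ε hε => ?_⟩
  obtain ⟨N, hN⟩ := key (ε / 2) (half_pos hε)
  refine ⟨N, fun n hn => ?_⟩
  rw [dist_eq_norm]
  refine lt_of_le_of_lt (norm_le_of_forall_coeff fun t => ?_) (half_lt_self hε)
  rw [map_sub]
  exact hN n hn t

end RestrictedSeries

/-! ### Leading exponents, division and noetherianity. -/

namespace RestrictedSeries

variable {𝕜 : Type*} [NormedField 𝕜] [IsUltrametricDist 𝕜] {σ : Type*} {ρ : σ → ℝ}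

lemma coeff_monomial_mul (s t : σ →₀ ℕ) (a : 𝕜) (f : RestrictedSeries 𝕜 ρ) :
    coeff s (monomial t a * f) = if t ≤ s then a * coeff (s - t) f else 0 := by
  classical
  exact (MvPowerSeries.coeff_monomial_mul s t f.1 a).trans (if_congr Iff.rfl rfl rfl)

lemma exists_weight_eq_zpow {τ : ℝ} (hτ : 0 < τ) (hρτ : ∀ j, ∃ k : ℤ, ρ j = τ ^ k)
    (t : σ →₀ ℕ) : ∃ k : ℤ, weight ρ t = τ ^ k := by
  choose k hk using hρτ
  refine ⟨t.sum fun j n => k j * n, ?_⟩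
  rw [weight, Finsupp.prod, Finsupp.sum]
  have : ∀ (s : Finset σ) (g : σ → ℤ), τ ^ (∑ j ∈ s, g j) = ∏ j ∈ s, τ ^ g j := by
    classical
    intro s g
    induction s using Finset.induction_on with
    | empty => simp
    | insert a s ha ih => rw [Finset.sum_insert ha, Finset.prod_insert ha, zpow_add₀ hτ.ne', ih]
  rw [this]
  refine Finset.prod_congr rfl fun j _ => ?_
  rw [hk, zpow_mul, zpow_natCast]

/-- The exponent `e` is leading in `f` for a monomial order if it is the largest exponent of the
terms of `f` at which the Gauss norm of `f` is attained. -/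
def IsLeading [Fact (∀ j, 0 < ρ j)] (m : MonomialOrder σ) (f : RestrictedSeries 𝕜 ρ)
    (e : σ →₀ ℕ) : Prop :=
  ‖coeff e f‖ * weight ρ e = ‖f‖ ∧
    ∀ t, m.toSyn e < m.toSyn t → ‖coeff t f‖ * weight ρ t < ‖f‖

variable [hρ : Fact (∀ j, 0 < ρ j)] {m : MonomialOrder σ}

/-- The norm is attained, and only at finitely many exponents, so one of them is largest. -/
lemma exists_isLeading (m : MonomialOrder σ) {f : RestrictedSeries 𝕜 ρ} (hf : f ≠ 0) :
    ∃ e, IsLeading m f e := by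
  have hfin := finite_le_coeff f (norm_pos_iff.2 hf)
  obtain ⟨t, ht⟩ := exists_coeff_eq_norm f
  obtain ⟨e, he, hmax⟩ := Finset.exists_max_image hfin.toFinset m.toSyn
    ⟨t, by simpa using ht.ge⟩
  refine ⟨e, le_antisymm (coeff_mul_weight_le_norm f e) (by simpa using he), fun t ht => ?_⟩
  by_contra h
  exact (hmax t (by simpa using not_lt.1 h)).not_gt ht

/-- Subtracting a suitable monomial multiple of `g` removes the leading term of `f` if it is
divisible by that of `g`. -/
lemma exists_cancel_leading {f g : RestrictedSeries 𝕜 ρ} (hg : g ≠ 0) {e d : σ →₀ ℕ}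
    (hf : IsLeading m f e) (hgd : IsLeading m g d) (hde : d ≤ e) :
    ∃ q : RestrictedSeries 𝕜 ρ, ‖q‖ * ‖g‖ = ‖f‖ ∧ ‖f - q * g‖ ≤ ‖f‖ ∧
      ∀ t, m.toSyn e ≤ m.toSyn t → f = 0 ∨ ‖coeff t (f - q * g)‖ * weight ρ t < ‖f‖ := by
  by_cases hf0 : f = 0
  · exact ⟨0, by simp [hf0]⟩
  have hgpos : 0 < ‖g‖ := norm_pos_iff.2 hg
  have hc0 : coeff d g ≠ 0 := fun h => by
    have := hgd.1
    rw [h, norm_zero, zero_mul] at this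
    exact hgpos.ne this
  set q : RestrictedSeries 𝕜 ρ := monomial (e - d) (coeff e f / coeff d g) with hq
  have hqg : ‖q‖ * ‖g‖ = ‖f‖ := by
    rw [hq, norm_monomial, ← hgd.1, ← hf.1, norm_div]
    have hw : weight ρ (e - d) * weight ρ d = weight ρ e := by
      rw [← weight_add, tsub_add_cancel_of_le hde]
    have := norm_ne_zero_iff.2 hc0
    rw [← hw]
    field_simp
  refine ⟨q, hqg, ?_, fun t ht => Or.inr ?_⟩
  · rw [sub_eq_add_neg]
    refine (IsUltrametricDist.norm_add_le_max _ _).trans (max_le le_rfl ?_)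
    rw [norm_neg, ← hqg]
    exact norm_mul_le _ _
  · have hfpos : 0 < ‖f‖ := norm_pos_iff.2 hf0
    rw [map_sub, hq, coeff_monomial_mul]
    -- At `e` itself the two terms cancel exactly. Beyond `e` the coefficients of `f` and of the
    -- shifted `g` are both strictly below the norm, and the ultrametric inequality keeps their
    -- difference there.
    rcases eq_or_lt_of_le ht with h | h
    · obtain rfl := m.toSyn.injective h
      rw [if_pos tsub_le_self, tsub_tsub_cancel_of_le hde, div_mul_cancel₀ _ hc0]
      simpa using hfpos
    · have h1 := hf.2 t h
      split_ifs with hle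
      · have hlt : m.toSyn d < m.toSyn (t - (e - d)) := by
          have h2 : m.toSyn (d + (e - d)) < m.toSyn (t - (e - d) + (e - d)) := by
            rwa [add_tsub_cancel_of_le hde, tsub_add_cancel_of_le hle]
          rw [map_add, map_add] at h2
          exact lt_of_add_lt_add_right h2
        have h2 := hgd.2 _ hlt
        have h3 : ‖coeff e f / coeff d g * coeff (t - (e - d)) g‖ * weight ρ t < ‖f‖ := by
          have hq0 : 0 < ‖q‖ := by
            by_contra h0
            have : ‖q‖ = 0 := le_antisymm (not_lt.1 h0) (norm_nonneg _)
            rw [this, zero_mul] at hqg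
            exact hfpos.ne hqg
          have := mul_lt_mul_of_pos_left h2 hq0
          rw [hqg] at this
          refine lt_of_eq_of_lt ?_ this
          have hw : weight ρ (t - (e - d)) * weight ρ (e - d) = weight ρ t := by
            rw [← weight_add, tsub_add_cancel_of_le hle]
          rw [hq, norm_monomial, norm_mul, ← hw]
          ring
        have h4 := IsUltrametricDist.norm_add_le_max (coeff t f)
          (-(coeff e f / coeff d g * coeff (t - (e - d)) g))
        rw [norm_neg, ← sub_eq_add_neg] at h4
        refine lt_of_le_of_lt (mul_le_mul_of_nonneg_right h4 (weight_pos t).le) ?_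
        rcases max_choice ‖coeff t f‖ ‖coeff e f / coeff d g * coeff (t - (e - d)) g‖ with h | h
        · rwa [h]
        · rwa [h]
      · simpa using h1

/-- Division with remainder of smaller norm by a family `G` whose leading exponents cover those of
the ideal `I`. -/
lemma exists_norm_sub_sum_lt {ι : Type*} [Fintype ι] {I : Ideal (RestrictedSeries 𝕜 ρ)}
    {G : ι → RestrictedSeries 𝕜 ρ} (hGI : ∀ i, G i ∈ I) (hG0 : ∀ i, G i ≠ 0) {d : ι → σ →₀ ℕ}
    (hGd : ∀ i, IsLeading m (G i) (d i))
    (hcover : ∀ f ∈ I, f ≠ 0 → ∀ e, IsLeading m f e → ∃ i, d i ≤ e)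
    {f : RestrictedSeries 𝕜 ρ} (hf : f ∈ I) (hf0 : f ≠ 0) :
    ∃ q : ι → RestrictedSeries 𝕜 ρ, (∀ i, ‖q i‖ * ‖G i‖ ≤ ‖f‖) ∧
      ‖f - ∑ i, q i * G i‖ < ‖f‖ := by
  classical
  obtain ⟨e, he⟩ := exists_isLeading m hf0
  -- One cancellation either lowers the norm, which ends the process, or keeps it and lowers the
  -- leading exponent. A monomial order is a well-order, so the second case cannot recur forever.
  induction hs : m.toSyn e using WellFoundedLT.induction generalizing f e with
  | ind s ih =>
    obtain ⟨i, hi⟩ := hcover f hf hf0 e he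
    obtain ⟨q, hq, hle, hlead⟩ := exists_cancel_leading (hG0 i) he (hGd i) hi
    have hsum : ∑ k, (Pi.single i q : ι → RestrictedSeries 𝕜 ρ) k * G k = q * G i := by
      rw [Finset.sum_eq_single i]
      · simp
      · intro k _ hk
        simp [Pi.single_eq_of_ne hk]
      · simp
    have hsingle : ∀ k, ‖(Pi.single i q : ι → RestrictedSeries 𝕜 ρ) k‖ * ‖G k‖ ≤ ‖f‖ := by
      intro k
      by_cases hk : k = i
      · subst hk
        simpa using hq.le
      · simp [Pi.single_eq_of_ne hk]
    rcases hle.lt_or_eq with hlt | heq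
    · exact ⟨Pi.single i q, hsingle, by rwa [hsum]⟩
    · have h0 : f - q * G i ≠ 0 := by
        rw [← norm_ne_zero_iff, heq]
        exact norm_ne_zero_iff.2 hf0
      have hI : f - q * G i ∈ I := I.sub_mem hf (I.mul_mem_left _ (hGI i))
      obtain ⟨e', he'⟩ := exists_isLeading m h0
      have hlt : m.toSyn e' < s := by
        by_contra h
        rcases hlead e' (hs.le.trans (not_lt.1 h)) with h | h
        · exact hf0 h
        · exact h.ne (he'.1.trans heq)
      obtain ⟨q', hq', hlt'⟩ := ih _ hlt hI h0 e' he' rfl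
      rw [heq] at hq' hlt'
      refine ⟨Pi.single i q + q', fun k => ?_, ?_⟩
      · have h1 : ‖(Pi.single i q + q' : ι → RestrictedSeries 𝕜 ρ) k‖ ≤ _ :=
          IsUltrametricDist.norm_add_le_max _ _
        refine (mul_le_mul_of_nonneg_right h1 (norm_nonneg _)).trans ?_
        rcases max_choice ‖(Pi.single i q : ι → RestrictedSeries 𝕜 ρ) k‖ ‖q' k‖ with h | h
        · rw [h]; exact hsingle k
        · rw [h]; exact hq' k
      · simp only [Pi.add_apply, add_mul, Finset.sum_add_distrib]
        rwa [hsum, ← sub_sub]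

/-- The norm is attained at some term, so it lies in the discrete group generated by `τ`. This turns
a strict drop of the norm into a drop by a factor `τ`. -/
lemma exists_norm_eq_zpow {τ : ℝ} (hτ : 0 < τ) (hρτ : ∀ j, ∃ k : ℤ, ρ j = τ ^ k)
    (h𝕜 : ∀ c : 𝕜, c ≠ 0 → ∃ k : ℤ, ‖c‖ = τ ^ k) {f : RestrictedSeries 𝕜 ρ} (hf : f ≠ 0) :
    ∃ k : ℤ, ‖f‖ = τ ^ k := by
  obtain ⟨t, ht⟩ := exists_coeff_eq_norm f
  have hc : coeff t f ≠ 0 := fun h => by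
    rw [h, norm_zero, zero_mul] at ht
    exact norm_ne_zero_iff.2 hf ht.symm
  obtain ⟨a, ha⟩ := h𝕜 _ hc
  obtain ⟨b, hb⟩ := exists_weight_eq_zpow hτ hρτ t
  exact ⟨a + b, by rw [← ht, ha, hb, zpow_add₀ hτ.ne']⟩

/-- The ring of power series converging on a closed polydisc is noetherian if the radii and the
absolute values of the coefficients are powers of one number. -/
theorem isNoetherianRing [Finite σ] [CompleteSpace 𝕜] {τ : ℝ} (hτ : 0 < τ) (hτ1 : τ < 1)
    (hρτ : ∀ j, ∃ k : ℤ, ρ j = τ ^ k) (h𝕜 : ∀ c : 𝕜, c ≠ 0 → ∃ k : ℤ, ‖c‖ = τ ^ k) :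
    IsNoetherianRing (RestrictedSeries 𝕜 ρ) := by
  classical
  cases nonempty_fintype σ
  -- Any order of the variables will do; it only serves to define a lexicographic monomial order.
  let _ : LinearOrder σ := LinearOrder.lift' (Fintype.equivFin σ) (Fintype.equivFin σ).injective
  let m : MonomialOrder σ := MonomialOrder.lex
  refine isNoetherianRing_iff_ideal_fg _ |>.2 fun I => ?_
  let L : Set (σ →₀ ℕ) := {e | ∃ f ∈ I, f ≠ 0 ∧ IsLeading m f e}
  let M : Set (σ →₀ ℕ) := {e | Minimal (· ∈ L) e}
  -- Dickson's lemma: the minimal leading exponents form an antichain in a well-quasi-order.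
  have hM : M.Finite := WellQuasiOrderedLE.finite_of_isAntichain (setOfPred_minimal_antichain _)
  have hML : ∀ d : M, (d : σ →₀ ℕ) ∈ L := fun d => d.2.prop
  choose G hGI hG0 hGd using hML
  let _ : Fintype M := hM.fintype
  have hcover : ∀ f ∈ I, f ≠ 0 → ∀ e, IsLeading m f e → ∃ d : M, (d : σ →₀ ℕ) ≤ e := by
    intro f hf hf0 e he
    obtain ⟨d, hde, hd⟩ := exists_minimal_le_of_wellFoundedLT (· ∈ L) e ⟨f, hf, hf0, he⟩
    exact ⟨⟨d, hd⟩, hde⟩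
  let Φ : (M → RestrictedSeries 𝕜 ρ) →+ RestrictedSeries 𝕜 ρ :=
    { toFun := fun q => ∑ i, q i * G i
      map_zero' := by simp
      map_add' := fun q q' => by simp [add_mul, Finset.sum_add_distrib] }
  have hΦ : Continuous Φ := by
    change Continuous fun q : M → RestrictedSeries 𝕜 ρ => ∑ i, q i * G i
    fun_prop
  have key := exists_eq_of_approx Φ hΦ I.toAddSubgroup (C := ∑ i, ‖G i‖⁻¹) hτ.le hτ1
    (fun q => I.sum_mem fun i _ => I.mul_mem_left _ (hGI i)) fun f hf => by
      by_cases hf0 : f = 0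
      · exact ⟨0, by simp [hf0]⟩
      obtain ⟨q, hq, hlt⟩ := exists_norm_sub_sum_lt hGI hG0 hGd hcover hf hf0
      refine ⟨q, (pi_norm_le_iff_of_nonneg (by positivity)).2 fun i => ?_, ?_⟩
      · have h1 : ‖q i‖ ≤ ‖G i‖⁻¹ * ‖f‖ := by
          rw [inv_mul_eq_div, le_div_iff₀ (norm_pos_iff.2 (hG0 i))]
          exact hq i
        refine h1.trans (mul_le_mul_of_nonneg_right ?_ (norm_nonneg _))
        exact Finset.single_le_sum (f := fun i => ‖G i‖⁻¹) (fun i _ => by positivity)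
          (Finset.mem_univ i)
      · change ‖f - ∑ i, q i * G i‖ ≤ τ * ‖f‖
        by_cases h0 : f - ∑ i, q i * G i = 0
        · rw [h0, norm_zero]
          positivity
        obtain ⟨a, ha⟩ := exists_norm_eq_zpow hτ hρτ h𝕜 h0
        obtain ⟨b, hb⟩ := exists_norm_eq_zpow hτ hρτ h𝕜 hf0
        rw [ha, hb] at hlt ⊢
        -- The exponents are integers, so `b < a` means `b + 1 ≤ a`, which is the contraction by
        -- `τ`.
        have hba : b < a := (zpow_lt_zpow_iff_right_of_lt_one₀ hτ hτ1).1 hlt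
        rw [← zpow_one_add₀ hτ.ne']
        exact (zpow_le_zpow_iff_right_of_lt_one₀ hτ hτ1).2 (by omega)
  refine ⟨Finset.univ.image G, le_antisymm (Ideal.span_le.2 ?_) fun f hf => ?_⟩
  · intro g hg
    obtain ⟨i, -, rfl⟩ := Finset.mem_image.1 hg
    exact hGI i
  · obtain ⟨q, rfl⟩ := key f hf
    exact Ideal.sum_mem _ fun i _ => Ideal.mul_mem_left _ _
      (Ideal.subset_span (by simp))

end RestrictedSeries

/-! ### Evaluation of restricted series in Banach rings. -/

namespace RestrictedSeries

variable {𝕜 : Type*} [NormedField 𝕜] [IsUltrametricDist 𝕜] {σ : Type*} {ρ : σ → ℝ}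
  {B : Type*} [NormedCommRing B] [IsUltrametricDist B] [CompleteSpace B]

/-- The value `b ^ t` of a monomial. -/
def monomialValue {B : Type*} [CommMonoid B] (b : σ → B) (t : σ →₀ ℕ) : B := t.prod (b · ^ ·)

lemma monomialValue_add {B : Type*} [CommMonoid B] (b : σ → B) (s t : σ →₀ ℕ) :
    monomialValue b (s + t) = monomialValue b s * monomialValue b t := by
  classical
  exact Finsupp.prod_add_index' (h := (b · ^ ·)) (by simp) (fun _ _ _ => pow_add _ _ _)

variable {ι : 𝕜 →+* B} {b : σ → B} {K : ℝ}

/-- In a complete ultrametric group, terms tending to zero suffice. The bound concerns whole terms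
and not each `b j`: under a norm that is only equivalent to a quotient norm, a variable of radius
`1` may have an image of norm above `1` while all its powers stay bounded by `K`. -/
lemma summable_eval (hb : ∀ t c, ‖ι c * monomialValue b t‖ ≤ K * (‖c‖ * weight ρ t))
    (f : RestrictedSeries 𝕜 ρ) :
    Summable fun t => ι (coeff t f) * monomialValue b t := by
  refine NonarchimedeanAddGroup.summable_of_tendsto_cofinite_zero ?_
  refine squeeze_zero_norm (fun t => hb t _) ?_
  simpa using (tendsto_coeff f).const_mul K

variable (hb : ∀ t c, ‖ι c * monomialValue b t‖ ≤ K * (‖c‖ * weight ρ t))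

/-- Evaluation of restricted power series at a tuple `b` of elements of a Banach ring. -/
def eval : RestrictedSeries 𝕜 ρ →+* B where
  toFun f := ∑' t, ι (coeff t f) * monomialValue b t
  map_one' := by
    classical
    rw [tsum_eq_single 0]
    · rw [← monomial_zero_one, coeff_monomial]
      simp [monomialValue]
    · intro t ht
      rw [← monomial_zero_one, coeff_monomial, if_neg ht]
      simp
  map_zero' := by simp
  map_add' f g := by
    rw [← (summable_eval hb f).tsum_add (summable_eval hb g)]
    simp [add_mul]
  map_mul' f g := by
    classical
    have hf := summable_eval hb f
    have hg := summable_eval hb g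
    have : NonarchimedeanRing B :=
      { is_nonarchimedean := NonarchimedeanAddGroup.is_nonarchimedean }
    have hfg := Summable.mul_of_nonarchimedean hf hg
    refine Eq.trans ?_ (hf.tsum_mul_tsum_eq_tsum_sum_antidiagonal hg hfg).symm
    refine tsum_congr fun t => ?_
    rw [coeff_mul, map_sum, Finset.sum_mul]
    refine Finset.sum_congr rfl fun x hx => ?_
    rw [← Finset.HasAntidiagonal.mem_antidiagonal.1 hx, monomialValue_add, map_mul]
    ring

lemma eval_monomial (t : σ →₀ ℕ) (a : 𝕜) :
    eval hb (monomial t a) = ι a * monomialValue b t := by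
  classical
  change ∑' s, ι (coeff s (monomial t a : RestrictedSeries 𝕜 ρ)) * monomialValue b s = _
  rw [tsum_eq_single t]
  · rw [coeff_monomial, if_pos rfl]
  · intro s hs
    rw [coeff_monomial, if_neg hs]
    simp

variable [hρ : Fact (∀ j, 0 < ρ j)]

lemma norm_eval_le (hK : 0 ≤ K) (f : RestrictedSeries 𝕜 ρ) : ‖eval hb f‖ ≤ K * ‖f‖ := by
  refine IsUltrametricDist.norm_tsum_le_of_forall_le_of_nonneg (by positivity) fun t => ?_
  exact (hb t _).trans (mul_le_mul_of_nonneg_left (coeff_mul_weight_le_norm f t) hK)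

lemma continuous_eval (hK : 0 ≤ K) : Continuous (eval hb) :=
  AddMonoidHomClass.continuous_of_bound _ K (norm_eval_le hb hK)

end RestrictedSeries

lemma UniformSpace.Completion.isUltrametricDist {E : Type*} [SeminormedAddCommGroup E]
    [IsUltrametricDist E] : IsUltrametricDist (UniformSpace.Completion E) := by
  refine IsUltrametricDist.isUltrametricDist_of_forall_norm_add_le_max_norm fun x y => ?_
  induction x, y using UniformSpace.Completion.induction_on₂ with
  | hp => apply isClosed_le <;> fun_prop
  | ih x y =>
    rw [← UniformSpace.Completion.coe_add]
    simpa only [UniformSpace.Completion.norm_coe] using IsUltrametricDist.norm_add_le_max x y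

namespace RestrictedSeries

lemma monomialValue_sumElim {B : Type*} [CommMonoid B] {σ κ : Type*} [Fintype σ] [Fintype κ]
    (x : σ → B) (y : κ → B) (t : σ →₀ ℕ) (n : κ →₀ ℕ) :
    monomialValue (Sum.elim x y) (Finsupp.sumElim t n) =
      monomialValue x t * monomialValue y n := by
  simp only [monomialValue]
  rw [Finsupp.prod_fintype _ _ (by simp), Finsupp.prod_fintype _ _ (by simp),
    Finsupp.prod_fintype _ _ (by simp), Fintype.prod_sum_type]
  rfl

lemma map_monomialValue {B B' F : Type*} [CommMonoid B] [CommMonoid B'] [FunLike F B B']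
    [MonoidHomClass F B B'] (φ : F) {σ : Type*} (b : σ → B) (t : σ →₀ ℕ) :
    φ (monomialValue b t) = monomialValue (fun j => φ (b j)) t := by
  simp [monomialValue, Finsupp.prod]

variable {𝕜 : Type*} [NormedField 𝕜] [IsUltrametricDist 𝕜] {σ : Type*} {ρ : σ → ℝ}

lemma monomial_one_eq (t : σ →₀ ℕ) : (monomial t 1 : RestrictedSeries 𝕜 ρ) =
    monomialValue (fun j => monomial (Finsupp.single j 1) 1) t := by
  induction t using Finsupp.induction_linear with
  | zero => rw [monomial_zero_one]; simp [monomialValue]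
  | add s t hs ht => rw [monomialValue_add, ← hs, ← ht, monomial_mul_monomial, one_mul]
  | single j n =>
    induction n with
    | zero => rw [Finsupp.single_zero, monomial_zero_one]; simp [monomialValue]
    | succ n ih =>
      rw [Finsupp.single_add, monomialValue_add, ← ih,
        ← one_mul (1 : 𝕜), ← monomial_mul_monomial, one_mul]
      congr 1
      simp [monomialValue]

lemma map_monomial {B : Type*} [CommRing B] (φ : RestrictedSeries 𝕜 ρ →+* B) (t : σ →₀ ℕ)
    (c : 𝕜) : φ (monomial t c) =
      φ (monomial 0 c) * monomialValue (fun j => φ (monomial (Finsupp.single j 1) 1)) t := by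
  rw [← map_monomialValue, ← monomial_one_eq, ← map_mul, monomial_mul_monomial, zero_add, mul_one]

variable [hρ : Fact (∀ j, 0 < ρ j)]

instance : NormedAlgebra 𝕜 (RestrictedSeries 𝕜 ρ) where
  __ := RingHom.toAlgebra
    { toFun := fun a : 𝕜 => (monomial 0 a : RestrictedSeries 𝕜 ρ)
      map_one' := monomial_zero_one
      map_mul' := fun a b => by rw [monomial_mul_monomial, add_zero]
      map_zero' := Subtype.ext (map_zero (MvPowerSeries.monomial 0))
      map_add' := fun a b => monomial_add 0 a b }
  norm_smul_le a f := by
    refine (norm_mul_le (monomial 0 a) f).trans_eq ?_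
    rw [norm_monomial]
    simp [weight]

instance {σ : Type*} : Fact (∀ _ : σ, (0 : ℝ) < 1) := ⟨fun _ => one_pos⟩

lemma smul_def (a : 𝕜) (f : RestrictedSeries 𝕜 ρ) : a • f = monomial 0 a * f := rfl

end RestrictedSeries

/-- Open mapping theorem for a bounded surjection of Banach spaces over `ℚ_[p]`. -/
lemma IsAffinoidAlgebra.exists_bounded_lift {p : ℕ} [Fact p.Prime] {A : Type*} [NormedCommRing A]
    [NormedAlgebra ℚ_[p] A] [CompleteSpace A] (hA : IsAffinoidAlgebra p A) :
    ∃ (m : ℕ) (φ : RestrictedSeries ℚ_[p] (fun _ : Fin m => (1 : ℝ)) →+* A) (K C : ℝ), 0 ≤ K ∧ 0 < C ∧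
      (∀ a, φ (RestrictedSeries.monomial 0 a) = algebraMap ℚ_[p] A a) ∧
      (∀ f, ‖φ f‖ ≤ K * ‖f‖) ∧ ∀ a, ∃ f, φ f = a ∧ ‖f‖ ≤ C * ‖a‖ := by
  obtain ⟨m, φ, hsurj, halg, K, hK⟩ := hA
  have halg' : ∀ a, φ (RestrictedSeries.monomial 0 a) = algebraMap ℚ_[p] A a := fun a => by
    rw [← halg a]
    exact congrArg φ (Subtype.ext (MvPowerSeries.monomial_zero_eq_C_apply a))
  have hK' : ∀ f, ‖φ f‖ ≤ |K| * ‖f‖ := fun f =>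
    (hK f).trans (mul_le_mul_of_nonneg_right (le_abs_self K) (norm_nonneg f))
  let L : RestrictedSeries ℚ_[p] (fun _ : Fin m => (1 : ℝ)) →ₗ[ℚ_[p]] A :=
    { toFun := φ
      map_add' := map_add φ
      map_smul' := fun a f => by
        rw [RestrictedSeries.smul_def, map_mul, halg', RingHom.id_apply, Algebra.smul_def] }
  obtain ⟨C, hC0, hC⟩ := (L.mkContinuous |K| hK').exists_preimage_norm_le hsurj
  exact ⟨m, φ, |K|, C, abs_nonneg K, hC0, halg', hK', hC⟩

/-! ### Monomials on the polyannulus and their norms. -/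

namespace AnnulusPolynomial

variable {p : ℕ} {A : Type*} [NormedCommRing A] {I : Type*} {s r : I → WithTop ℚ}

/-- The monomial `a T ^ i`. -/
def monomial (i : annulusExponents s r) (a : A) : AnnulusPolynomial p A s r :=
  AddMonoidAlgebra.single i a

lemma monomial_mul_monomial (i j : annulusExponents s r) (a b : A) :
    (monomial i a * monomial j b : AnnulusPolynomial p A s r) = monomial (i + j) (a * b) :=
  AddMonoidAlgebra.single_mul_single i j a b

lemma monomial_zero_one : (monomial 0 1 : AnnulusPolynomial p A s r) = 1 := rfl

lemma monomial_add (i : annulusExponents s r) (a b : A) :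
    (monomial i (a + b) : AnnulusPolynomial p A s r) = monomial i a + monomial i b :=
  AddMonoidAlgebra.single_add i a b

lemma monomial_sub (i : annulusExponents s r) (a b : A) :
    (monomial i (a - b) : AnnulusPolynomial p A s r) = monomial i a - monomial i b :=
  AddMonoidAlgebra.single_sub i a b

lemma monomial_zero (i : annulusExponents s r) :
    (monomial i 0 : AnnulusPolynomial p A s r) = 0 :=
  AddMonoidAlgebra.single_zero i

lemma sum_monomial_coeff (f : AnnulusPolynomial p A s r) :
    ∑ i ∈ f.coeff.support, monomial i (f.coeff i) = f :=
  AddMonoidAlgebra.sum_coeff_single f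

lemma coeff_monomial [DecidableEq (annulusExponents s r)] (i j : annulusExponents s r) (a : A) :
    (monomial i a : AnnulusPolynomial p A s r).coeff j = if i = j then a else 0 :=
  Finsupp.single_apply

/-- Constants, as a ring homomorphism. -/
def C : A →+* AnnulusPolynomial p A s r where
  toFun := monomial 0
  map_one' := monomial_zero_one
  map_mul' a b := by rw [monomial_mul_monomial, add_zero]
  map_zero' := monomial_zero 0
  map_add' := monomial_add 0

lemma C_mul_monomial (i : annulusExponents s r) (a : A) :
    (C a * monomial i 1 : AnnulusPolynomial p A s r) = monomial i a := by
  change monomial 0 a * monomial i 1 = _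
  rw [monomial_mul_monomial, zero_add, mul_one]

lemma monomialValue_monomial {κ : Type*} (e : κ → annulusExponents s r) (n : κ →₀ ℕ) :
    RestrictedSeries.monomialValue
      (fun k => (monomial (e k) 1 : AnnulusPolynomial p A s r)) n =
        monomial (n.sum fun k j => j • e k) 1 := by
  classical
  induction n using Finsupp.induction_linear with
  | zero => simp [RestrictedSeries.monomialValue, monomial_zero_one]
  | add n n' h h' =>
    rw [RestrictedSeries.monomialValue_add, h, h', monomial_mul_monomial, mul_one,
      Finsupp.sum_add_index' (by simp) fun _ _ _ => add_smul _ _ _]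
  | single k j =>
    simp only [RestrictedSeries.monomialValue, Finsupp.prod_single_index, pow_zero,
      Finsupp.sum_single_index, zero_smul]
    induction j with
    | zero => simp [monomial_zero_one]
    | succ j ih => rw [pow_succ, ih, monomial_mul_monomial, mul_one, succ_nsmul]

variable [Fact p.Prime] [IsUltrametricDist A] [Fintype I]

instance : IsUltrametricDist (AnnulusPolynomial p A s r) := by
  refine IsUltrametricDist.isUltrametricDist_of_forall_norm_add_le_max_norm fun f g => ?_
  have h : (f + g).annulusNorm ≤ max f.annulusNorm g.annulusNorm :=
    Finset.sup_le fun J _ => gaussNorm_le fun i => by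
      have h1 : ‖(f + g).coeff i‖₊ ≤ max ‖f.coeff i‖₊ ‖g.coeff i‖₊ :=
        IsUltrametricDist.norm_add_le_max (f.coeff i) (g.coeff i)
      have h2 := mul_le_mul_left h1 (monomialWeight p (annulusVertex s r J) i)
      rcases max_choice ‖f.coeff i‖₊ ‖g.coeff i‖₊ with h | h
      · rw [h] at h2
        exact le_max_of_le_left
          (h2.trans ((le_gaussNorm _ f i).trans (gaussNorm_le_annulusNorm f J)))
      · rw [h] at h2
        exact le_max_of_le_right
          (h2.trans ((le_gaussNorm _ g i).trans (gaussNorm_le_annulusNorm g J)))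
  exact_mod_cast h

lemma norm_monomial_le {i : annulusExponents s r} {a : A} {W : ℝ}
    (hW : ∀ J, (monomialWeight p (annulusVertex s r J) i : ℝ) ≤ W) :
    ‖(monomial i a : AnnulusPolynomial p A s r)‖ ≤ ‖a‖ * W := by
  classical
  have hW0 : 0 ≤ W := NNReal.zero_le_coe.trans (hW ∅)
  lift W to ℝ≥0 using hW0
  have h : (monomial i a : AnnulusPolynomial p A s r).annulusNorm ≤ ‖a‖₊ * W :=
    Finset.sup_le fun J _ => gaussNorm_le fun j => by
      rw [coeff_monomial]
      split_ifs with hij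
      · subst hij
        exact mul_le_mul' le_rfl (by exact_mod_cast hW J)
      · simp
  exact_mod_cast h

lemma coeff_mul_monomialWeight_le_norm (f : AnnulusPolynomial p A s r)
    (i : annulusExponents s r) (J : Finset I) :
    ‖f.coeff i‖ * monomialWeight p (annulusVertex s r J) i ≤ ‖f‖ := by
  have h := (le_gaussNorm (annulusVertex s r J) f i).trans (gaussNorm_le_annulusNorm f J)
  exact_mod_cast h

/-- Weights at a vertex are multiplicative. Only an inequality can hold, since `ρ k` may strictly
exceed the weight of `e k` at this vertex. -/
lemma monomialWeight_sum_le {κ : Type*} {e : κ → annulusExponents s r} {ρ : κ → ℝ}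
    (J : Finset I) (hρ : ∀ k, (monomialWeight p (annulusVertex s r J) (e k) : ℝ) ≤ ρ k)
    (n : κ →₀ ℕ) :
    (monomialWeight p (annulusVertex s r J)
      ((n.sum fun k j => j • e k : annulusExponents s r) : I → ℤ) : ℝ) ≤
        RestrictedSeries.weight ρ n := by
  classical
  induction n using Finsupp.induction_linear with
  | zero => simp [RestrictedSeries.weight, monomialWeight_zero]
  | add n n' h h' =>
    rw [RestrictedSeries.weight_add,
      Finsupp.sum_add_index' (by simp) fun _ _ _ => add_smul _ _ _, monomialWeight_add,
      NNReal.coe_mul]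
    exact mul_le_mul h h' NNReal.zero_le_coe (NNReal.zero_le_coe.trans h)
  | single k j =>
    simp only [RestrictedSeries.weight, Finsupp.prod_single_index, pow_zero,
      Finsupp.sum_single_index, zero_smul]
    induction j with
    | zero => simp [monomialWeight_zero]
    | succ j ih =>
      rw [pow_succ, succ_nsmul, monomialWeight_add, NNReal.coe_mul]
      exact mul_le_mul ih (hρ k) NNReal.zero_le_coe (NNReal.zero_le_coe.trans ih)

end AnnulusPolynomial

/-! ### Presentation of the analytic functions as a quotient. -/

open RestrictedSeries in
/-- The ring of analytic functions on a polyannulus is noetherian if its exponent monoid has finitely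
many generators `e` for which the norm of each monomial is the product of the radii `ρ` of
generators, all norms being powers of one number. -/
theorem AnnulusRing.isNoetherianRing_of_generators {p : ℕ} [Fact p.Prime] {A : Type*}
    [NormedCommRing A] [NormedAlgebra ℚ_[p] A] [IsUltrametricDist A] [CompleteSpace A]
    (hA : IsAffinoidAlgebra p A) {I : Type*} [Fintype I] {s r : I → WithTop ℚ}
    {κ : Type*} [Fintype κ] (e : κ → annulusExponents s r) {ρ : κ → ℝ} (hρ : ∀ k, 0 < ρ k)
    (hle : ∀ k J, (monomialWeight p (annulusVertex s r J) (e k) : ℝ) ≤ ρ k)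
    (hgen : ∀ i : annulusExponents s r, ∃ n : κ →₀ ℕ, (n.sum fun k j => j • e k) = i ∧
      ∃ J, weight ρ n ≤ monomialWeight p (annulusVertex s r J) i)
    {τ : ℝ} (hτ : 0 < τ) (hτ1 : τ < 1) (hρτ : ∀ k, ∃ j : ℤ, ρ k = τ ^ j)
    (hpτ : ∀ c : ℚ_[p], c ≠ 0 → ∃ j : ℤ, ‖c‖ = τ ^ j) :
    IsNoetherianRing (AnnulusRing p A s r) := by
  obtain ⟨m, φ, K, C, hK0, hC0, halg, hK, hC⟩ := hA.exists_bounded_lift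
  have : IsUltrametricDist (AnnulusRing p A s r) :=
    UniformSpace.Completion.isUltrametricDist
  let incl : AnnulusPolynomial p A s r →+* AnnulusRing p A s r :=
    UniformSpace.Completion.coeRingHom
  let R : Fin m ⊕ κ → ℝ := Sum.elim (fun _ => 1) ρ
  have hR : Fact (∀ j, 0 < R j) := ⟨by rintro (j | k); exacts [one_pos, hρ k]⟩
  let x : Fin m → A := fun j => φ (RestrictedSeries.monomial (Finsupp.single j 1) 1)
  let P : Fin m ⊕ κ → AnnulusPolynomial p A s r :=
    Sum.elim (fun j => AnnulusPolynomial.C (x j)) fun k => AnnulusPolynomial.monomial (e k) 1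
  let ι : ℚ_[p] →+* AnnulusRing p A s r :=
    (incl.comp AnnulusPolynomial.C).comp (algebraMap ℚ_[p] A)
  let b : Fin m ⊕ κ → AnnulusRing p A s r := fun j => incl (P j)
  have hval : ∀ (t : Fin m →₀ ℕ) (n : κ →₀ ℕ) (c : ℚ_[p]),
      ι c * monomialValue b (Finsupp.sumElim t n) =
        incl (AnnulusPolynomial.monomial (n.sum fun k j => j • e k)
          (φ (RestrictedSeries.monomial t c))) := by
    intro t n c
    rw [← AnnulusPolynomial.C_mul_monomial, map_monomial φ t c, halg, map_mul, map_mul, map_mul,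
      map_monomialValue AnnulusPolynomial.C, ← AnnulusPolynomial.monomialValue_monomial,
      ← map_monomialValue incl P, monomialValue_sumElim, map_mul, mul_assoc]
    rfl
  have hweight : ∀ (t : Fin m →₀ ℕ) (n : κ →₀ ℕ), weight R (Finsupp.sumElim t n) =
      weight (fun _ => 1) t * weight ρ n := monomialValue_sumElim _ _
  have hmon : ∀ (n : κ →₀ ℕ) (a : A), ‖(AnnulusPolynomial.monomial (n.sum fun k j => j • e k) a :
      AnnulusPolynomial p A s r)‖ ≤ ‖a‖ * weight ρ n := fun n a =>
    AnnulusPolynomial.norm_monomial_le fun J =>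
      AnnulusPolynomial.monomialWeight_sum_le J (fun k => hle k J) n
  have hincl : ∀ f, ‖incl f‖ = ‖f‖ := UniformSpace.Completion.norm_coe
  have hwρ : ∀ n, 0 < weight ρ n := fun n =>
    haveI : Fact (∀ k, 0 < ρ k) := ⟨hρ⟩
    weight_pos n
  have hb : ∀ u c, ‖ι c * monomialValue b u‖ ≤ K * (‖c‖ * weight R u) := by
    intro u c
    obtain ⟨⟨t, n⟩, rfl⟩ := Finsupp.sumFinsuppEquivProdFinsupp.symm.surjective u
    change ‖ι c * monomialValue b (Finsupp.sumElim t n)‖ ≤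
      K * (‖c‖ * weight R (Finsupp.sumElim t n))
    rw [hval, hincl, hweight, ← mul_assoc ‖c‖, ← mul_assoc K]
    refine (hmon _ _).trans (mul_le_mul_of_nonneg_right ?_ (hwρ n).le)
    simpa only [norm_monomial] using hK (RestrictedSeries.monomial t c)
  let Ψ : RestrictedSeries ℚ_[p] R →+* AnnulusRing p A s r := eval hb
  -- To approximate `a T ^ i`, lift `a` to the Tate algebra, truncate the lift to a polynomial and
  -- multiply by the monomial of exponent `n` above `T ^ i`. Both bounds use the weight at a single
  -- vertex, which the annulus norm dominates.
  have hterm : ∀ (i : annulusExponents s r) (a : A), ∃ J, ∃ f : RestrictedSeries ℚ_[p] R,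
      ‖f‖ ≤ C * (‖a‖ * monomialWeight p (annulusVertex s r J) i) ∧
      ‖incl (AnnulusPolynomial.monomial i a) - Ψ f‖ ≤
        2⁻¹ * (‖a‖ * monomialWeight p (annulusVertex s r J) i) := by
    intro i a
    obtain ⟨n, rfl, J, hJ⟩ := hgen i
    refine ⟨J, ?_⟩
    by_cases ha : a = 0
    · refine ⟨0, ?_⟩
      rw [ha, AnnulusPolynomial.monomial_zero]
      simp
    have hapos : 0 < ‖a‖ := norm_pos_iff.2 ha
    obtain ⟨g, hga, hg⟩ := hC a
    -- Applying `φ` multiplies the truncation error by at most `K`, leaving at most `‖a‖ / 2`; the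
    -- denominator `K + 1` avoids dividing by zero.
    obtain ⟨S, hS⟩ := exists_norm_sub_sum_monomial_le g
      (ε := 2⁻¹ * ‖a‖ / (K + 1)) (by positivity)
    refine ⟨∑ t ∈ S, RestrictedSeries.monomial (Finsupp.sumElim t n) (coeff t g), ?_, ?_⟩
    · refine IsUltrametricDist.norm_sum_le_of_forall_le_of_nonneg (by positivity) fun t _ => ?_
      rw [norm_monomial, hweight, ← mul_assoc, ← mul_assoc]
      exact mul_le_mul ((coeff_mul_weight_le_norm g t).trans hg) hJ (hwρ n).le (by positivity)
    · have h1 : Ψ (∑ t ∈ S, RestrictedSeries.monomial (Finsupp.sumElim t n) (coeff t g)) =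
          incl (AnnulusPolynomial.monomial (n.sum fun k j => j • e k)
            (φ (∑ t ∈ S, RestrictedSeries.monomial t (coeff t g)))) := by
        rw [map_sum, map_sum, ← AnnulusPolynomial.C_mul_monomial, map_sum, Finset.sum_mul,
          map_sum]
        refine Finset.sum_congr rfl fun t _ => ?_
        rw [AnnulusPolynomial.C_mul_monomial, ← hval]
        exact eval_monomial hb _ _
      rw [h1, ← map_sub, hincl, ← AnnulusPolynomial.monomial_sub, ← mul_assoc]
      nth_rw 1 [← hga]
      rw [← map_sub]
      refine (hmon _ _).trans (mul_le_mul ?_ hJ (hwρ n).le (by positivity))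
      refine (hK _).trans ((mul_le_mul_of_nonneg_left hS hK0).trans ?_)
      rw [mul_div_assoc', div_le_iff₀ (by positivity)]
      nlinarith
  choose J F hFnorm hFapprox using hterm
  have hpoly : ∀ Q : AnnulusPolynomial p A s r, ∃ f : RestrictedSeries ℚ_[p] R,
      ‖f‖ ≤ C * ‖Q‖ ∧ ‖incl Q - Ψ f‖ ≤ 2⁻¹ * ‖Q‖ := by
    intro Q
    refine ⟨∑ i ∈ Q.coeff.support, F i (Q.coeff i), ?_, ?_⟩
    · refine IsUltrametricDist.norm_sum_le_of_forall_le_of_nonneg (by positivity) fun i _ => ?_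
      refine (hFnorm _ _).trans (mul_le_mul_of_nonneg_left ?_ hC0.le)
      exact AnnulusPolynomial.coeff_mul_monomialWeight_le_norm Q i _
    · have hQ : incl Q = ∑ i ∈ Q.coeff.support,
          incl (AnnulusPolynomial.monomial i (Q.coeff i)) := by
        rw [← map_sum, AnnulusPolynomial.sum_monomial_coeff]
      rw [hQ, map_sum, ← Finset.sum_sub_distrib]
      refine IsUltrametricDist.norm_sum_le_of_forall_le_of_nonneg (by positivity) fun i _ => ?_
      refine (hFapprox _ _).trans (mul_le_mul_of_nonneg_left ?_ (by norm_num))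
      exact AnnulusPolynomial.coeff_mul_monomialWeight_le_norm Q i _
  have hsurj : Function.Surjective Ψ := by
    intro y
    refine exists_eq_of_approx Ψ.toAddMonoidHom (continuous_eval hb hK0) ⊤ (C := C) (θ := 2⁻¹)
      (by norm_num) (by norm_num) (fun _ => AddSubgroup.mem_top _) (fun y _ => ?_) y
      (AddSubgroup.mem_top y)
    by_cases hy : y = 0
    · exact ⟨0, by simp [hy]⟩
    obtain ⟨Q, hQ⟩ : ∃ Q, ‖y - incl Q‖ ≤ 2⁻¹ * ‖y‖ := by
      have hpos : 0 < 2⁻¹ * ‖y‖ := mul_pos (by norm_num) (norm_pos_iff.2 hy)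
      obtain ⟨Q, hQ⟩ := UniformSpace.Completion.denseRange_coe.exists_dist_lt y hpos
      exact ⟨Q, by rw [← dist_eq_norm]; exact hQ.le⟩
    -- As `Q` is no larger than `y`, the constants `C` and `2⁻¹` pass unchanged from polynomials to
    -- the completion.
    have hQy : ‖Q‖ ≤ ‖y‖ := by
      have h := IsUltrametricDist.norm_add_le_max y (-(y - incl Q))
      rw [norm_neg, neg_sub, add_sub_cancel, hincl] at h
      exact h.trans (max_le le_rfl (hQ.trans (by linarith [norm_nonneg y])))
    obtain ⟨f, hf, hfQ⟩ := hpoly Q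
    refine ⟨f, hf.trans (by gcongr), ?_⟩
    have h := IsUltrametricDist.norm_add_le_max (y - incl Q) (incl Q - Ψ f)
    rw [sub_add_sub_cancel] at h
    exact h.trans (max_le hQ (hfQ.trans (by gcongr)))
  have hnoeth : IsNoetherianRing (RestrictedSeries ℚ_[p] R) := by
    refine RestrictedSeries.isNoetherianRing hτ hτ1 ?_ hpτ
    rintro (j | k)
    exacts [⟨0, (zpow_zero τ).symm⟩, hρτ k]
  exact isNoetherianRing_of_surjective _ _ Ψ hsurj

/-! ### Radii as powers of a common base. -/

lemma circleRadius_anti {p : ℕ} [hp : Fact p.Prime] : Antitone (circleRadius p) := by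
  intro s r h
  have hp1 : (1 : ℝ) < p := by exact_mod_cast hp.out.one_lt
  induction r using WithTop.recTopCoe with
  | top => exact zero_le
  | coe r =>
    induction s using WithTop.recTopCoe with
    | top => exact absurd h (by simp)
    | coe s =>
      have hsr : (s : ℝ) ≤ r := by exact_mod_cast WithTop.coe_le_coe.1 h
      refine NNReal.rpow_le_rpow_of_exponent_le (by exact_mod_cast hp1.le) ?_
      have : (0 : ℝ) < p - 1 := by linarith
      gcongr

lemma exists_natCast_mul_eq_intCast {κ : Type*} [Finite κ] (q : κ → ℚ) :
    ∃ N : ℕ, 0 < N ∧ ∀ k, ∃ z : ℤ, (N : ℚ) * q k = z := by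
  classical
  cases nonempty_fintype κ
  refine ⟨∏ k, (q k).den, Finset.prod_pos fun k _ => (q k).pos, fun k => ?_⟩
  refine ⟨(∏ j ∈ Finset.univ.erase k, (q j).den : ℕ) * (q k).num, ?_⟩
  rw [← Finset.mul_prod_erase Finset.univ _ (Finset.mem_univ k)]
  push_cast
  rw [mul_comm ((q k).den : ℚ), mul_assoc, Rat.den_mul_eq_num]

/-- Finitely many radii of circles and all absolute values on `ℚ_p` are powers of one number. -/
lemma exists_common_base (p : ℕ) [hp : Fact p.Prime] {κ : Type*} [Finite κ] (t : κ → WithTop ℚ) :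
    ∃ τ : ℝ, 0 < τ ∧ τ < 1 ∧
      (∀ k, t k ≠ ⊤ → ∃ j : ℤ, (circleRadius p (t k) : ℝ) = τ ^ j) ∧
      ∀ c : ℚ_[p], c ≠ 0 → ∃ j : ℤ, ‖c‖ = τ ^ j := by
  -- With `N` a common denominator of the finite parameters, `τ = p ^ (-1 / (N (p - 1)))` works: a
  -- radius with parameter `q` is `τ ^ (N q)`, and an element of valuation `v` has norm `τ ^ (N (p -
  -- 1) v)`. Infinite parameters enter as a harmless `0`.
  obtain ⟨N, hN, hq⟩ := exists_natCast_mul_eq_intCast fun k => (t k).untopD 0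
  have hp1 : (1 : ℝ) < p := by exact_mod_cast hp.out.one_lt
  have hp0 : (0 : ℝ) < p := by linarith
  have hp' : (0 : ℝ) < p - 1 := by linarith
  have hN' : (0 : ℝ) < N := by exact_mod_cast hN
  have hpow : ∀ j : ℤ, ((p : ℝ) ^ (-(1 / (N * ((p : ℝ) - 1))))) ^ j =
      (p : ℝ) ^ (-(j / (N * ((p : ℝ) - 1)))) := fun j => by
    rw [← Real.rpow_intCast, ← Real.rpow_mul hp0.le]
    congr 1
    ring
  refine ⟨(p : ℝ) ^ (-(1 / (N * ((p : ℝ) - 1)))), Real.rpow_pos_of_pos hp0 _,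
    Real.rpow_lt_one_of_one_lt_of_neg hp1 (neg_neg_of_pos (by positivity)), fun k hk => ?_,
    fun c hc => ?_⟩
  · obtain ⟨z, hz⟩ := hq k
    obtain ⟨q, hqk⟩ := WithTop.ne_top_iff_exists.1 hk
    rw [← hqk, WithTop.untopD_coe] at hz
    have hz' : (N : ℝ) * q = z := by exact_mod_cast hz
    refine ⟨z, ?_⟩
    rw [hpow, ← hqk, ← hz']
    change (((p : ℝ≥0) ^ (-(q : ℝ) / ((p : ℝ) - 1)) : ℝ≥0) : ℝ) = _
    rw [NNReal.coe_rpow, NNReal.coe_natCast]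
    congr 1
    field_simp
  · refine ⟨N * (p - 1) * c.valuation, ?_⟩
    rw [hpow, Padic.norm_eq_zpow_neg_valuation hc, ← Real.rpow_intCast]
    congr 1
    push_cast
    field_simp

/-! ### Generators of the exponent monoid and the main theorem. -/

open RestrictedSeries in
/-- The ring of analytic functions on a polyannulus `[s, r]` with finite `s` and `s ≤ r` is
noetherian. -/
theorem AnnulusRing.isNoetherianRing {p : ℕ} [Fact p.Prime] {A : Type*}
    [NormedCommRing A] [NormedAlgebra ℚ_[p] A] [IsUltrametricDist A] [CompleteSpace A]
    (hA : IsAffinoidAlgebra p A) {I : Type*} [Fintype I] {s r : I → WithTop ℚ}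
    (hs : ∀ α, s α ≠ ⊤) (hsr : ∀ α, s α ≤ r α) :
    IsNoetherianRing (AnnulusRing p A s r) := by
  classical
  obtain ⟨τ, hτ, hτ1, hcirc, hpτ⟩ := exists_common_base p (Sum.elim s r)
  -- The generators are `T_α` and `T_α⁻¹`. In a disc direction there is no inverse, and its place is
  -- taken by the trivial monomial `1` of radius `1`.
  let e : I ⊕ I → annulusExponents s r := Sum.elim
    (fun α => ⟨Pi.single α 1, fun β _ => by
      rw [Pi.single_apply]
      split_ifs <;> simp⟩)
    (fun α => if h : r α = ⊤ then 0 else ⟨-Pi.single α 1, fun β hβ => by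
      have hβα : β ≠ α := by
        rintro rfl
        exact hβ.elim (hs β) h
      simp [Pi.single_eq_of_ne hβα]⟩)
  let ρ : I ⊕ I → ℝ := Sum.elim (fun α => circleRadius p (s α))
    (fun α => if r α = ⊤ then 1 else (circleRadius p (r α) : ℝ)⁻¹)
  have hpos : ∀ t : WithTop ℚ, t ≠ ⊤ → (0 : ℝ) < circleRadius p t := fun t ht =>
    NNReal.coe_pos.2 (pos_iff_ne_zero.2 (AnnulusPolynomial.circleRadius_ne_zero ht))
  have hvs : ∀ J α, circleRadius p (annulusVertex s r J α) ≤ circleRadius p (s α) := by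
    intro J α
    unfold annulusVertex
    split_ifs
    exacts [circleRadius_anti (hsr α), le_rfl]
  have hvr : ∀ J α, circleRadius p (r α) ≤ circleRadius p (annulusVertex s r J α) := by
    intro J α
    unfold annulusVertex
    split_ifs
    exacts [le_rfl, circleRadius_anti (hsr α)]
  refine AnnulusRing.isNoetherianRing_of_generators hA e (ρ := ρ) ?_ ?_ ?_ hτ hτ1 ?_ hpτ
  · rintro (α | α)
    · exact hpos _ (hs α)
    · change 0 < if r α = ⊤ then 1 else (circleRadius p (r α) : ℝ)⁻¹
      split_ifs with h
      · exact one_pos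
      · exact inv_pos.2 (hpos _ h)
  · rintro (α | α) J
    · change ((∏ β, circleRadius p (annulusVertex s r J β) ^ (Pi.single α 1 : I → ℤ) β : ℝ≥0) : ℝ)
        ≤ circleRadius p (s α)
      rw [Finset.prod_eq_single α (fun β _ h => by simp [Pi.single_eq_of_ne h]) (by simp)]
      simpa using hvs J α
    · by_cases h : r α = ⊤
      · have he : e (Sum.inr α) = 0 := dif_pos h
        have hρ : ρ (Sum.inr α) = 1 := if_pos h
        rw [he, hρ]
        simp [AnnulusPolynomial.monomialWeight_zero]
      · have he : (e (Sum.inr α) : I → ℤ) = -Pi.single α 1 :=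
          congrArg Subtype.val (dif_neg h)
        have hρ : ρ (Sum.inr α) = (circleRadius p (r α) : ℝ)⁻¹ := if_neg h
        rw [he, hρ, monomialWeight,
          Finset.prod_eq_single α (fun β _ h => by simp [Pi.single_eq_of_ne h]) (by simp)]
        simp only [Pi.neg_apply, Pi.single_eq_same, zpow_neg, zpow_one, NNReal.coe_inv]
        exact inv_anti₀ (hpos _ h) (hvr J α)
  · intro i
    -- Split `i` into positive and negative parts. The vertex takes `r α` exactly where `i α < 0`
    -- and `s α` elsewhere, so the weight of `T ^ i` there equals the product of the radii of the
    -- generators used.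
    refine ⟨Finsupp.equivFunOnFinite.symm
      (Sum.elim (fun α => (i.1 α).toNat) fun α => (-i.1 α).toNat), ?_,
      Finset.univ.filter fun α => i.1 α < 0, ?_⟩
    · rw [Finsupp.sum_fintype _ _ (by simp), Fintype.sum_sum_type]
      apply Subtype.ext
      funext β
      simp only [AddSubmonoid.coe_add, AddSubmonoid.coe_finsetSum, Pi.add_apply,
        Finset.sum_apply, AddSubmonoidClass.coe_nsmul, Pi.smul_apply,
        Finsupp.equivFunOnFinite_symm_apply_apply, Sum.elim_inl, Sum.elim_inr]
      rw [Finset.sum_eq_single β, Finset.sum_eq_single β]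
      · by_cases h : r β = ⊤
        · have he : (e (Sum.inr β) : I → ℤ) = 0 := congrArg Subtype.val (dif_pos h)
          have hi := i.2 β (Or.inr h)
          rw [he]
          simp [e, hi]
        · have he : (e (Sum.inr β) : I → ℤ) = -Pi.single β 1 :=
            congrArg Subtype.val (dif_neg h)
          rw [he]
          simp only [e, Sum.elim_inl, Pi.single_eq_same, Pi.neg_apply, nsmul_eq_mul]
          omega
      · intro α _ hα
        by_cases h : r α = ⊤
        · have he : (e (Sum.inr α) : I → ℤ) = 0 := congrArg Subtype.val (dif_pos h)
          simp [he]
        · have he : (e (Sum.inr α) : I → ℤ) = -Pi.single α 1 :=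
            congrArg Subtype.val (dif_neg h)
          simp [he, Pi.single_eq_of_ne hα.symm]
      · simp
      · intro α _ hα
        simp [e, Pi.single_eq_of_ne hα.symm]
      · simp
    · rw [weight, Finsupp.prod_fintype _ _ (by simp), Fintype.prod_sum_type, monomialWeight,
        NNReal.coe_prod, ← Finset.prod_mul_distrib]
      refine (Finset.prod_congr rfl fun α _ => ?_).le
      simp only [Finsupp.equivFunOnFinite_symm_apply_apply, Sum.elim_inl, Sum.elim_inr, ρ]
      by_cases hi : i.1 α < 0
      · have h : r α ≠ ⊤ := fun h => (i.2 α (Or.inr h)).not_gt hi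
        obtain ⟨k, hk⟩ := Int.eq_ofNat_of_zero_le (neg_nonneg.2 hi.le)
        have hk' : i.1 α = -(k : ℤ) := by omega
        have hv : annulusVertex s r (Finset.univ.filter fun α => i.1 α < 0) α = r α :=
          if_pos (by simpa using hi)
        rw [hv, if_neg h, hk']
        simp
      · obtain ⟨k, hk⟩ := Int.eq_ofNat_of_zero_le (not_lt.1 hi)
        have hv : annulusVertex s r (Finset.univ.filter fun α => i.1 α < 0) α = s α :=
          if_neg (by simpa using hi)
        rw [hv, hk]
        simp
  · rintro (α | α)
    · exact hcirc (Sum.inl α) (hs α)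
    · change ∃ j : ℤ, (if r α = ⊤ then 1 else (circleRadius p (r α) : ℝ)⁻¹) = τ ^ j
      split_ifs with h
      · exact ⟨0, (zpow_zero τ).symm⟩
      · obtain ⟨j, hj⟩ := hcirc (Sum.inr α) h
        exact ⟨-j, by rw [zpow_neg, ← hj]; rfl⟩

end

theorem mainTheorem4 (p : ℕ) [Fact p.Prime] (A : Type*) [NormedCommRing A] [NormedAlgebra ℚ_[p] A]
    [IsUltrametricDist A] [CompleteSpace A] (hA : IsAffinoidAlgebra p A)
    (I : Type*) [Fintype I] (r : ℕ → I → WithTop ℚ)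
    (hpos : ∀ n α, 0 < r n α)
    (hanti : ∀ n α, r (n + 1) α ≤ r n α)
    (hlt : ∀ α, r 1 α < r 0 α)
    (hfin : (∀ α, r 0 α ≠ ⊤) ∨ (∀ α, r 0 α = ⊤)) :
    ∀ n, 1 ≤ n →
      IsNoetherianRing (AnnulusRing p A (r n) (r 0)) ∧
      IsNoetherianRing (AnnulusRing p A (r n) (fun _ => ⊤)) := by
  intro n hn
  have hlt' : ∀ α, r n α < r 0 α := fun α =>
    (antitone_nat_of_succ_le (f := fun n => r n α) (fun n => hanti n α) hn).trans_lt (hlt α)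
  -- Being strictly below `r 0 α` forces `r n α` to be finite, so both rings fall under the same
  -- theorem.
  have hs : ∀ α, r n α ≠ ⊤ := fun α => (hlt' α).ne_top
  exact ⟨AnnulusRing.isNoetherianRing hA hs fun α => (hlt' α).le,
    AnnulusRing.isNoetherianRing hA hs fun _ => le_top⟩
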